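/- Let $k$ be a field of characteristic different from $2$ and let $n\ge 0$. Multiply permutations in the symmetric group $S_n$ by composition, $(\sigma\tau)(i)=\sigma(\tau(i))$. For $\sigma\in S_n$ set $\sigma(0)=0$ and $$\mathrm{Peak}(\sigma)=\{\,i : 1\le i\le n-1,\ \sigma(i-1)<\sigma(i)>\sigma(i+1)\,\}.$$ In the group algebra $kS_n$ put $$p_j=\sum_{\#\mathrm{Peak}(\sigma)=j}\sigma\quad(0\le j\le\lfloor n/2\rfloor),\qquad p^0_j=\sum_{\#(\mathrm{Peak}(\sigma)\setminus\{1\})=j-1}\sigma\quad(1\le j\le\lfloor (n+1)/2\rfloor).$$ Let $m!!=m(m-2)(m-4)\cdots$ for $m\ge 1$ (the last factor being $2$ or $1$), $0!!=(-1)!!=1$, and $$\rho_{(n)}=\sum_{j=0}^{\lfloor n/2\rfloor}(-1)^j\frac{(2j-1)!!\,(n-2j-1)!!}{n!!}\,p_j,\qquad \rho_{(0,n)}=\sum_{j=1}^{\lfloor (n+1)/2\rfloor}(-1)^{j-1}\frac{(2j-2)!!\,(n-2j)!!}{n!!}\,p^0_j,$$ where the coefficients are rational numbers, read in $k$ as reduced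 fractions. (For $n$ even the reduced denominators of the coefficients of $\rho_{(n)}$ are powers of $2$, so $\rho_{(n)}$ is defined over every such $k$. For $n$ odd, the coefficients of $\rho_{(0,n)}$ are defined in $k$ exactly when $n!!\ne 0$ in $k$, that is, when the characteristic of $k$ is $0$ or greater than $n$.) 1. If $n$ is even, the left ideal $kS_n\cdot\rho_{(n)}$ satisfies $$\dim_k\,(kS_n)\,\rho_{(n)}=\big((n-1)!!\big)^2 .$$ 2. If $n$ is odd and $n!!\neq 0$ in $k$, the left ideal $kS_n\cdot\rho_{(0,n)}$ satisfies $$\dim_k\,(kS_n)\,\rho_{(0,n)}=(n-1)!\,.$$ -/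

import Mathlib

open scoped Nat

namespace PeakAlgebra

/-- The one-line notation of `σ ∈ S_n` with one-based positions and values, extended by the
convention `σ(0) = 0`. Position `i + 1` of `[n]` is the element `i` of `Fin n`.
Positions larger than `n` are never looked at below. -/
def word {n : ℕ} (σ : Equiv.Perm (Fin n)) : ℕ → ℕ
  | 0 => 0
  | i + 1 => if h : i < n then (σ ⟨i, h⟩ : ℕ) + 1 else 0

/-- `Peak(σ) = {i ∈ [n-1] | σ(i-1) < σ(i) > σ(i+1)}`, where `σ(0) = 0`; so `1` is a peak
as soon as `σ(1) > σ(2)`. -/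
def peak {n : ℕ} (σ : Equiv.Perm (Fin n)) : Finset ℕ :=
  {i ∈ Finset.Icc 1 (n - 1) | word σ (i - 1) < word σ i ∧ word σ (i + 1) < word σ i}

/-- `p_j`, the sum in `k S_n` of all permutations with exactly `j` peaks. -/
noncomputable def p (k : Type*) [Field k] (n j : ℕ) : MonoidAlgebra k (Equiv.Perm (Fin n)) :=
  ∑ σ : Equiv.Perm (Fin n) with (peak σ).card = j, MonoidAlgebra.of k _ σ

/-- `p⁰_j` (for `j ≥ 1`), the sum in `k S_n` of all permutations with exactly `j - 1`
interior peaks, that is, peaks other than `1`. -/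
noncomputable def pInterior (k : Type*) [Field k] (n j : ℕ) :
    MonoidAlgebra k (Equiv.Perm (Fin n)) :=
  ∑ σ : Equiv.Perm (Fin n) with (peak σ \ {1}).card = j - 1, MonoidAlgebra.of k _ σ

/-- The rational number `(-1)^j (2j-1)!! (n-2j-1)!! / n!!`, for `2j ≤ n`. The convention
`(-1)!! = 1` agrees with truncated subtraction, as `0 - 1 = 0` and `0!! = 1` in `ℕ`. -/
def rhoCoeff (n j : ℕ) : ℚ :=
  (-1) ^ j * (((2 * j - 1)‼ * (n - 2 * j - 1)‼ : ℕ) : ℚ) / ((n‼ : ℕ) : ℚ)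

/-- The rational number `(-1)^(j-1) (2j-2)!! (n-2j)!! / n!!`, for `2 ≤ 2j ≤ n + 1`. Again
truncated subtraction agrees with `(-1)!! = 1`. -/
def rhoZeroCoeff (n j : ℕ) : ℚ :=
  (-1) ^ (j - 1) * (((2 * j - 2)‼ * (n - 2 * j)‼ : ℕ) : ℚ) / ((n‼ : ℕ) : ℚ)

/-- `ρ_(n) = ∑_{j=0}^{⌊n/2⌋} (-1)^j (2j-1)!! (n-2j-1)!! / n!! · p_j`. The coefficients are
rational numbers, read in `k` as reduced fractions. For even `n` their denominators are powers
of `2`, so the element makes sense over every field of characteristic different from `2`;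
if `n!!` is invertible in `k`, this is the same as dividing by `n!!` in `k`. -/
noncomputable def rho (k : Type*) [Field k] (n : ℕ) : MonoidAlgebra k (Equiv.Perm (Fin n)) :=
  ∑ j ∈ Finset.range (n / 2 + 1), (rhoCoeff n j : k) • p k n j

/-- `ρ_(0,n) = ∑_{j=1}^{⌊(n+1)/2⌋} (-1)^(j-1) (2j-2)!! (n-2j)!! / n!! · p⁰_j`. For odd `n`
the coefficients can be read in `k` exactly when `n!!` is invertible in `k`. -/
noncomputable def rhoZero (k : Type*) [Field k] (n : ℕ) :
    MonoidAlgebra k (Equiv.Perm (Fin n)) :=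
  ∑ j ∈ Finset.Icc 1 ((n + 1) / 2), (rhoZeroCoeff n j : k) • pInterior k n j

end PeakAlgebra

/-! Let h_m be the sum of `sortCount m σ` • σ: each σ is counted once for every function f from [n]
to {0, …, m-1} that it sorts, larger values first, ties increasing at even values and decreasing at
odd ones. Each f is sorted by exactly one σ, and a signed lexicographic pairing of functions gives
h_a h_b = h_{ba} (`sum_sortCount_mul`).

Sorted functions are walks, and for σ with j peaks the counts for m = 2a+1 have generating function
(4x)^j (1+x)^(n-2j) / (1-x)^(n+1) in a; for m = 2a and j interior peaks it is 2x (4x)^j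
(1+x)^(n-1-2j) / (1-x)^(n+1) (`walks_generating`). So for large a the counts are polynomials in a
depending only on j, and the product rule extends to rational a. In the odd family a = -1/2 stands
for m = 0 and gives an idempotent, which for even n is ρ_(n) (`oddPoly_eval`). In the even family
P(s) P(t) = P(2st), so P'(0)/2 is idempotent, and for odd n it is ρ_(0,n) (`evenPoly_derivative`).

The left ideal of an idempotent has dimension equal to the trace of right multiplication, which is
n! times the coefficient of the identity. In characteristic p this only gives the dimension modulo
p. Clearing denominators yields an integer matrix with A² = DA and D invertible in k, and such a
matrix has the same rank over k as over ℚ (`rank_map_intCast_of_mul_self`). -/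

namespace PeakAlgebra

/-! ### Ranks of integer quasi-idempotent matrices -/

section IntegerMatrices

variable {ι : Type*} [Fintype ι] [DecidableEq ι]

/-- A ℤ-basis of the column lattice reduces to a spanning family of the column space over `K`. -/
theorem rank_map_intCast_le (K : Type*) [Field K] (A : Matrix ι ι ℤ) :
    (A.map (Int.cast : ℤ → K)).rank ≤ Module.finrank ℤ (LinearMap.range A.mulVecLin) := by
  classical
  set M := LinearMap.range A.mulVecLin
  let b := Module.finBasis ℤ M
  let v : Fin (Module.finrank ℤ M) → ι → K := fun i j => (((b i : M) : ι → ℤ) j : K)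
  have hle : Submodule.span K (Set.range (A.map (Int.cast : ℤ → K)).col) ≤
      Submodule.span K (Set.range v) := by
    rw [Submodule.span_le]
    rintro _ ⟨j, rfl⟩
    have hj : A.col j ∈ M := ⟨Pi.single j 1, by simp⟩
    have h := b.sum_repr ⟨A.col j, hj⟩
    have h2 : (A.map (Int.cast : ℤ → K)).col j =
        ∑ i, ((b.repr ⟨A.col j, hj⟩ i : ℤ) : K) • v i := by
      ext l
      have h3 := congrFun (congrArg Subtype.val h) l
      simp only [Submodule.coe_sum, Submodule.coe_smul, Finset.sum_apply, Pi.smul_apply,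
        smul_eq_mul] at h3
      simp only [Finset.sum_apply, Pi.smul_apply, smul_eq_mul, v]
      have h4 := congrArg (Int.cast : ℤ → K) h3
      push_cast at h4
      rw [h4]
      rfl
    rw [h2]
    exact Submodule.sum_mem _ fun i _ => Submodule.smul_mem _ _ (Submodule.subset_span ⟨i, rfl⟩)
  rw [Matrix.rank_eq_finrank_span_cols]
  refine (Submodule.finrank_mono hle).trans ?_
  have h := finrank_range_le_card (R := K) v
  rwa [Fintype.card_fin] at h

/-- An integer matrix with `A² = D A` has the same rank over every field in which `D ≠ 0`. -/
theorem rank_map_intCast_of_mul_self (K : Type*) [Field K] (A : Matrix ι ι ℤ) {D : ℤ}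
    (hA : A * A = D • A) (hD : (D : K) ≠ 0) :
    (A.map (Int.cast : ℤ → K)).rank = Module.finrank ℤ (LinearMap.range A.mulVecLin) := by
  have hD0 : D ≠ 0 := by rintro rfl; simp at hD
  -- `A` and `D - A` are complementary up to the factor `D`. Over `K` their ranges span, since the
  -- sum is invertible; over ℤ their ranges are independent, since `A * B = 0`. As reduction can
  -- only lower each rank, both inequalities are equalities.
  set B : Matrix ι ι ℤ := D • 1 - A with hB
  have h1 := rank_map_intCast_le K A
  have h2 := rank_map_intCast_le K B
  have h3 : Fintype.card ι ≤ (A.map (Int.cast : ℤ → K)).rank +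
      (B.map (Int.cast : ℤ → K)).rank := by
    have hsum : A.map (Int.cast : ℤ → K) + B.map (Int.cast : ℤ → K) = (D : K) • 1 := by
      ext i j
      by_cases hij : i = j <;> simp [hB, hij, -zsmul_eq_mul, -zsmul_one]
    have htop : LinearMap.range (A.map (Int.cast : ℤ → K)).mulVecLin ⊔
        LinearMap.range (B.map (Int.cast : ℤ → K)).mulVecLin = ⊤ := by
      rw [eq_top_iff]
      intro x _
      have hx : x = (A.map (Int.cast : ℤ → K)).mulVec ((D : K)⁻¹ • x) +
          (B.map (Int.cast : ℤ → K)).mulVec ((D : K)⁻¹ • x) := by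
        rw [← Matrix.add_mulVec, hsum, Matrix.smul_mulVec, Matrix.one_mulVec, smul_inv_smul₀ hD]
      rw [hx]
      exact Submodule.add_mem_sup ⟨_, rfl⟩ ⟨_, rfl⟩
    have h := Submodule.finrank_add_le_finrank_add_finrank
      (LinearMap.range (A.map (Int.cast : ℤ → K)).mulVecLin)
      (LinearMap.range (B.map (Int.cast : ℤ → K)).mulVecLin)
    rw [htop, finrank_top, Module.finrank_fintype_fun_eq_card] at h
    exact h
  have h4 : Module.finrank ℤ (LinearMap.range A.mulVecLin) +
      Module.finrank ℤ (LinearMap.range B.mulVecLin) ≤ Fintype.card ι := by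
    have hinj : Function.Injective ((LinearMap.range A.mulVecLin).subtype.coprod
        (LinearMap.range B.mulVecLin).subtype) := by
      rw [← LinearMap.ker_eq_bot, LinearMap.ker_eq_bot']
      rintro ⟨⟨_, x, rfl⟩, ⟨_, y, rfl⟩⟩ h
      simp only [LinearMap.coprod_apply, Submodule.subtype_apply, Matrix.mulVecLin_apply] at h
      have hAB : A * B = 0 := by
        rw [hB, Matrix.mul_sub, hA, Matrix.mul_smul, Matrix.mul_one, sub_self]
      have hAx : A.mulVec x = 0 := by
        have := congrArg A.mulVec h
        rw [Matrix.mulVec_add, Matrix.mulVec_mulVec, Matrix.mulVec_mulVec, hAB, hA,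
          Matrix.zero_mulVec, add_zero, Matrix.mulVec_zero, Matrix.smul_mulVec] at this
        exact (smul_eq_zero.mp this).resolve_left hD0
      rw [hAx, zero_add] at h
      simp [hAx, h]
    have h := LinearMap.finrank_le_finrank_of_injective hinj
    rwa [Module.finrank_prod, Module.finrank_fintype_fun_eq_card] at h
  omega

theorem rank_eq_trace_of_isIdempotentElem (K : Type*) [Field K] (E : Matrix ι ι K)
    (hE : E * E = E) : (E.rank : K) = E.trace := by
  have h : IsIdempotentElem (Matrix.toLin' E) := by
    rw [IsIdempotentElem, Module.End.mul_eq_comp, ← Matrix.toLin'_mul, hE]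
  rw [← Matrix.trace_toLin'_eq, (LinearMap.IsIdempotentElem.isProj_range _ h).trace]
  rfl

/-- The rank is moved from `K` to ℚ, where the trace of the idempotent `A / D` determines it. -/
theorem rank_mul_eq_trace_of_mul_self (K : Type*) [Field K] (A : Matrix ι ι ℤ) {D : ℤ}
    (hA : A * A = D • A) (hD : (D : K) ≠ 0) :
    D * ((A.map (Int.cast : ℤ → K)).rank : ℤ) = A.trace := by
  have hD0 : (D : ℚ) ≠ 0 := by
    intro h
    have : D = 0 := by exact_mod_cast h
    simp [this] at hD
  rw [rank_map_intCast_of_mul_self K A hA hD, ← rank_map_intCast_of_mul_self ℚ A hA hD0]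
  set B := A.map (Int.cast : ℤ → ℚ) with hB
  have hBB : B * B = (D : ℚ) • B := by
    have := congrArg (fun M : Matrix ι ι ℤ => M.map (Int.castRingHom ℚ)) hA
    simp only [Matrix.map_mul] at this
    rw [hB]
    refine this.trans ?_
    ext i j
    simp [-zsmul_eq_mul]
  have hidem : ((D : ℚ)⁻¹ • B) * ((D : ℚ)⁻¹ • B) = (D : ℚ)⁻¹ • B := by
    rw [Matrix.smul_mul, Matrix.mul_smul, hBB, inv_smul_smul₀ hD0]
  have h := rank_eq_trace_of_isIdempotentElem ℚ _ hidem
  rw [Matrix.rank_smul_of_mem_nonZeroDivisors _ (by simpa using hD0), Matrix.trace_smul,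
    smul_eq_mul, eq_inv_mul_iff_mul_eq₀ hD0] at h
  have htr : B.trace = (A.trace : ℚ) := by simp [hB, Matrix.trace]
  rw [htr] at h
  exact_mod_cast h

end IntegerMatrices

/-! ### Left ideals of a group algebra and convolution matrices -/

section GroupAlgebra

variable {G : Type*} [Group G] [Fintype G]

/-- The matrix of right multiplication by `∑ c g • g`. -/
def convMatrix {R : Type*} (c : G → R) : Matrix G G R := Matrix.of fun x y => c (y⁻¹ * x)

theorem sum_smul_mul_sum_smul (K : Type*) [Field K] (x c : G → K) :
    (∑ g, x g • MonoidAlgebra.of K G g) * (∑ g, c g • MonoidAlgebra.of K G g) =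
      ∑ g, (convMatrix c).mulVec x g • MonoidAlgebra.of K G g := by
  simp only [Matrix.mulVec, dotProduct, Finset.sum_smul, Finset.sum_mul, Finset.mul_sum]
  rw [Finset.sum_comm]
  conv_rhs => rw [Finset.sum_comm]
  refine Finset.sum_congr rfl fun y _ => ?_
  refine Fintype.sum_equiv (Equiv.mulLeft y) _ _ fun z => ?_
  simp [convMatrix, mul_comm]

theorem finrank_span_singleton_eq_rank (K : Type*) [Field K] (c : G → K) :
    Module.finrank K (Ideal.span {∑ g, c g • MonoidAlgebra.of K G g} :
      Ideal (MonoidAlgebra K G)) = (convMatrix c).rank := by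
  classical
  let L : (G → K) ≃ₗ[K] MonoidAlgebra K G :=
    (Finsupp.linearEquivFunOnFinite K K G).symm.trans (MonoidAlgebra.coeffLinearEquiv K).symm
  have hL : ∀ x : G → K, L x = ∑ g, x g • MonoidAlgebra.of K G g := by
    intro x
    apply (MonoidAlgebra.coeffLinearEquiv (S := K) (M := G) K).injective
    ext g
    simp [L, Finsupp.single_apply]
  have hmap : (LinearMap.range (convMatrix c).mulVecLin).map L.toLinearMap =
      (Ideal.span {∑ g, c g • MonoidAlgebra.of K G g} :
        Ideal (MonoidAlgebra K G)).restrictScalars K := by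
    ext y
    simp only [Submodule.mem_map, LinearMap.mem_range, Submodule.restrictScalars_mem,
      Ideal.mem_span_singleton', Matrix.mulVecLin_apply, exists_exists_eq_and,
      LinearEquiv.coe_coe]
    constructor
    · rintro ⟨x, rfl⟩
      exact ⟨L x, by rw [hL, hL, sum_smul_mul_sum_smul]⟩
    · rintro ⟨z, rfl⟩
      refine ⟨L.symm z, ?_⟩
      rw [hL, ← sum_smul_mul_sum_smul, ← hL, L.apply_symm_apply]
  have h := L.finrank_map_eq (LinearMap.range (convMatrix c).mulVecLin)
  rw [hmap] at h
  exact h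

/-- The dimension of the left ideal generated by a quasi-idempotent with integer coefficients. -/
theorem finrank_span_of_quasiIdempotent (K : Type*) [Field K] (c : G → ℤ) {D : ℤ}
    (hc : ∀ x, ∑ y, c y * c (y⁻¹ * x) = D * c x) (hD : (D : K) ≠ 0) :
    D * (Module.finrank K (Ideal.span {∑ g, ((c g : K) / D) • MonoidAlgebra.of K G g} :
      Ideal (MonoidAlgebra K G)) : ℤ) = Fintype.card G * c 1 := by
  classical
  have hA : convMatrix c * convMatrix c = D • convMatrix c := by
    ext x z
    rw [Matrix.mul_apply, Matrix.smul_apply, smul_eq_mul]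
    simp only [convMatrix, Matrix.of_apply]
    rw [← hc]
    refine Fintype.sum_equiv (Equiv.mulLeft z⁻¹) _ _ fun y => ?_
    simp [mul_assoc, mul_comm]
  have h := rank_mul_eq_trace_of_mul_self K _ hA hD
  have hmat : convMatrix (fun g => (c g : K) / D) =
      (D : K)⁻¹ • (convMatrix c).map (Int.cast : ℤ → K) := by
    ext x y
    simp [convMatrix, div_eq_inv_mul]
  rw [finrank_span_singleton_eq_rank, hmat,
    Matrix.rank_smul_of_mem_nonZeroDivisors _ (by simpa using hD), h]
  simp [Matrix.trace, convMatrix]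

end GroupAlgebra

/-! ### Signed sorting and the multiplication rule -/

section SignedSorting

variable {n m : ℕ}

/-- The sorting key of a position: larger values of `f` come first; ties are broken increasingly
where `f` is even and decreasingly where `f` is odd. -/
def sortKey (f : Fin n → Fin m) (v : Fin n) : ℤ ×ₗ ℤ :=
  toLex (-((f v : ℕ) : ℤ), if Even (f v : ℕ) then ((v : ℕ) : ℤ) else -((v : ℕ) : ℤ))

theorem sortKey_lt_iff (f : Fin n → Fin m) (v w : Fin n) :
    sortKey f v < sortKey f w ↔
      f w < f v ∨ f v = f w ∧ if Even (f v : ℕ) then v < w else w < v := by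
  rw [sortKey, sortKey, Prod.Lex.toLex_lt_toLex]
  simp only [neg_lt_neg_iff, neg_inj, Nat.cast_lt, Nat.cast_inj, Fin.val_fin_lt, Fin.val_inj]
  refine or_congr Iff.rfl (and_congr_right fun h => ?_)
  rw [h]
  split_ifs <;> simp

theorem sortKey_injective (f : Fin n → Fin m) : Function.Injective (sortKey f) := by
  intro v w h
  have h1 := (sortKey_lt_iff f v w).not.mp (by simp [h])
  have h2 := (sortKey_lt_iff f w v).not.mp (by simp [h])
  push Not at h1 h2
  have hf : f v = f w := le_antisymm h2.1 h1.1 |>.symm ▸ rfl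
  have h1 := h1.2 hf
  have h2 := h2.2 hf.symm
  rw [hf] at h1
  split_ifs at h1 h2 <;> omega

/-- The permutation `σ` lists the positions in the order prescribed by `f`. -/
def Sorts (f : Fin n → Fin m) (σ : Equiv.Perm (Fin n)) : Prop :=
  StrictMono (sortKey f ∘ σ)

/-- Keys are distinct, so each `f` is sorted by exactly one permutation. -/
theorem sorts_iff_eq_sort (f : Fin n → Fin m) (σ : Equiv.Perm (Fin n)) :
    Sorts f σ ↔ σ = Tuple.sort (sortKey f) := by
  have hs : Sorts f (Tuple.sort (sortKey f)) :=
    (Tuple.monotone_sort _).strictMono_of_injective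
      ((sortKey_injective f).comp (Equiv.injective _))
  refine ⟨fun h => ?_, fun h => h ▸ hs⟩
  have := Tuple.unique_monotone h.monotone hs.monotone
  ext i
  exact congrArg Fin.val (sortKey_injective f (congrFun this i))

open Classical in
/-- The number of functions `f` into `Fin m` that are sorted by `σ`. -/
noncomputable def sortCount (m : ℕ) (σ : Equiv.Perm (Fin n)) : ℕ :=
  Fintype.card {f : Fin n → Fin m // Sorts f σ}

/-- Lexicographic encoding of pairs in `Fin b × Fin a`, running backwards in the second coordinate
where the first one is odd. -/
def snakeEquiv (a b : ℕ) : Fin b × Fin a ≃ Fin (b * a) :=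
  (Equiv.prodShear (Equiv.refl (Fin b))
    fun c => if Even (c : ℕ) then Equiv.refl (Fin a) else Fin.revPerm).trans finProdFinEquiv

theorem snakeEquiv_val {a b : ℕ} (c : Fin b) (d : Fin a) :
    (snakeEquiv a b (c, d) : ℕ) =
      a * c + if Even (c : ℕ) then (d : ℕ) else a - 1 - d := by
  have := d.2
  simp only [snakeEquiv, Equiv.trans_apply, Equiv.prodShear_apply, Equiv.refl_apply]
  split_ifs <;> simp <;> omega

theorem snakeEquiv_lt_of_lt {a b : ℕ} {c c' : Fin b} (h : c < c') (d d' : Fin a) :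
    snakeEquiv a b (c, d) < snakeEquiv a b (c', d') := by
  rw [Fin.lt_def, snakeEquiv_val, snakeEquiv_val]
  have h1 : a * ((c : ℕ) + 1) ≤ a * c' := Nat.mul_le_mul_left _ h
  have := d.2
  have := d'.2
  rw [mul_add, mul_one] at h1
  split_ifs <;> omega

theorem snakeEquiv_lt_iff {a b : ℕ} (c : Fin b) (d d' : Fin a) :
    snakeEquiv a b (c, d) < snakeEquiv a b (c, d') ↔ if Even (c : ℕ) then d < d' else d' < d := by
  rw [Fin.lt_def, snakeEquiv_val, snakeEquiv_val]
  have := d.2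
  have := d'.2
  split_ifs <;> omega

/-- With parity read as a sign, the encoding multiplies signs; running backwards over odd `c` makes
this true for every `a`. -/
theorem even_snakeEquiv_iff {a b : ℕ} (c : Fin b) (d : Fin a) :
    Even (snakeEquiv a b (c, d) : ℕ) ↔ (Even (c : ℕ) ↔ Even (d : ℕ)) := by
  rw [snakeEquiv_val]
  have hd := d.2
  split_ifs with h
  · simp [Nat.even_add, h]
  · obtain ⟨e, he⟩ : ∃ e, a = d + 1 + e := ⟨a - (d + 1), by omega⟩
    have h2 : a - 1 - d = e := by omega
    rw [h2, Nat.even_add, Nat.even_mul]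
    simp only [h, or_false, false_iff]
    have h3 : Even a ↔ (Even ((d : ℕ) + 1) ↔ Even e) := by
      rw [← Nat.even_add]
      exact iff_of_eq (congrArg Even he)
    rw [h3, Nat.even_add_one]
    tauto

/-- Where `g` is tied, the comparison passes to `f`, hence to the order of positions under `σ`. At
an odd tie the reversed encoding and the flipped parity together reverse that order, as `sortKey g`
demands. -/
theorem sortKey_snakeEquiv_lt_iff {a b : ℕ} (f : Fin n → Fin a) (g : Fin n → Fin b)
    {σ : Equiv.Perm (Fin n)} (hσ : Sorts f σ) (i j : Fin n) :
    sortKey (fun v => snakeEquiv a b (g (σ.symm v), f v)) (σ i) <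
      sortKey (fun v => snakeEquiv a b (g (σ.symm v), f v)) (σ j) ↔ sortKey g i < sortKey g j := by
  have hij : ∀ i j : Fin n, i < j ↔ sortKey f (σ i) < sortKey f (σ j) := fun i j =>
    (hσ.lt_iff_lt).symm
  rw [sortKey_lt_iff, sortKey_lt_iff]
  simp only [Equiv.symm_apply_apply]
  rcases lt_trichotomy (g i) (g j) with h | h | h
  · have h1 := snakeEquiv_lt_of_lt h (f (σ i)) (f (σ j))
    simp [h.not_gt, h.ne, h1.not_gt, h1.ne]
  · rw [← h, snakeEquiv_lt_iff, (snakeEquiv a b).apply_eq_iff_eq]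
    simp only [even_snakeEquiv_iff, Prod.mk.injEq, true_and, lt_self_iff_false, false_or]
    rw [hij i j, hij j i, sortKey_lt_iff, sortKey_lt_iff]
    by_cases hc : Even (g i : ℕ)
    · simp [hc]
    · simp only [hc, if_false, false_iff]
      refine or_congr Iff.rfl ?_
      rw [eq_comm]
      refine and_congr_right fun hf => ?_
      rw [hf]
      split_ifs <;> simp_all
  · have h1 := snakeEquiv_lt_of_lt h (f (σ j)) (f (σ i))
    simp [h, h1]

theorem sorts_snakeEquiv_iff {a b : ℕ} (f : Fin n → Fin a) (g : Fin n → Fin b)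
    {σ : Equiv.Perm (Fin n)} (hσ : Sorts f σ) (τ : Equiv.Perm (Fin n)) :
    Sorts (fun v => snakeEquiv a b (g (σ.symm v), f v)) (σ * τ) ↔ Sorts g τ := by
  simp only [Sorts, StrictMono, Function.comp_apply, Equiv.Perm.mul_apply,
    sortKey_snakeEquiv_lt_iff f g hσ]

/-- The elements `∑ sortCount m σ • σ` multiply like the integers `m`. -/
theorem sum_sortCount_mul (a b : ℕ) (π : Equiv.Perm (Fin n)) :
    ∑ σ : Equiv.Perm (Fin n), sortCount a σ * sortCount b (σ⁻¹ * π) = sortCount (b * a) π := by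
  classical
  have h1 : ∀ σ : Equiv.Perm (Fin n), sortCount a σ * sortCount b (σ⁻¹ * π) =
      ∑ f : Fin n → Fin a, ∑ g : Fin n → Fin b,
        if Sorts f σ then (if Sorts g (σ⁻¹ * π) then 1 else 0) else 0 := by
    intro σ
    rw [sortCount, sortCount, Fintype.card_subtype, Fintype.card_subtype, Finset.card_filter,
      Finset.card_filter, Finset.sum_mul_sum]
    refine Finset.sum_congr rfl fun f _ => Finset.sum_congr rfl fun g _ => ?_
    split_ifs <;> rfl
  simp_rw [h1]
  rw [Finset.sum_comm, sortCount, Fintype.card_subtype, Finset.card_filter]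
  have h2 : ∀ f : Fin n → Fin a, (∑ σ : Equiv.Perm (Fin n), ∑ g : Fin n → Fin b,
      if Sorts f σ then (if Sorts g (σ⁻¹ * π) then 1 else 0) else 0) =
      ∑ g : Fin n → Fin b, if Sorts (fun v => snakeEquiv a b (g v, f v)) π then 1 else 0 := by
    intro f
    set σ := Tuple.sort (sortKey f) with hσ
    have hs : Sorts f σ := (sorts_iff_eq_sort f σ).mpr hσ
    rw [Finset.sum_eq_single σ]
    -- The substitution is `g ↦ g ∘ σ⁻¹`, with `σ` the permutation sorting `f`.
    · refine Fintype.sum_equiv (Equiv.arrowCongr σ (Equiv.refl _)) _ _ fun g => ?_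
      rw [if_pos hs]
      have := sorts_snakeEquiv_iff f g hs (σ⁻¹ * π)
      rw [mul_inv_cancel_left] at this
      simp only [← this]
      rfl
    · intro τ _ hτ
      have : ¬ Sorts f τ := fun h => hτ ((sorts_iff_eq_sort f τ).mp h)
      simp [this]
    · simp
  simp_rw [h2]
  rw [Finset.sum_comm, ← Fintype.sum_prod_type']
  refine Fintype.sum_equiv ((Equiv.arrowProdEquivProdArrow _ _ _).symm.trans
    (Equiv.arrowCongr (Equiv.refl _) (snakeEquiv a b))) _ _ fun p => ?_
  rfl

end SignedSorting

/-! ### Sorted functions as walks, and peaks -/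

section Walks

/-- The number of weakly decreasing walks `y = y₀ ≥ y₁ ≥ ⋯ ≥ yₙ ≥ 0` in which a step `i` with
`yᵢ = yᵢ₊₁` is allowed for even `yᵢ` if `d i = false` and for odd `yᵢ` if `d i = true`. -/
def walks : ℕ → (ℕ → Bool) → ℕ → ℕ
  | 0, _, _ => 1
  | n + 1, d, y => ∑ x ∈ Finset.range y, walks n (fun i => d (i + 1)) x +
      if Even y ↔ d 0 = false then walks n (fun i => d (i + 1)) y else 0

/-- The steps that are allowed in `walks`. -/
def IsStep (b : Bool) (y x : ℕ) : Prop := x < y ∨ x = y ∧ (Even y ↔ b = false)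

open Classical in
theorem walks_eq_sum (m n : ℕ) (d : ℕ → Bool) (y : ℕ) (hy : y < m) :
    walks n d y = ∑ g : Fin n → Fin m,
      if ∀ i : Fin n, IsStep (d i) (Fin.cons (α := fun _ => ℕ) y (fun j => (g j : ℕ)) i.castSucc)
        (g i) then 1 else 0 := by
  induction n generalizing d y with
  | zero => simp [walks]
  | succ n ih =>
    rw [← (Fin.consEquiv fun _ : Fin (n + 1) => Fin m).sum_comp, Fintype.sum_prod_type]
    have h1 : ∀ (x : Fin m), (∑ g : Fin n → Fin m,
        if ∀ i : Fin (n + 1), IsStep (d i) (Fin.cons (α := fun _ => ℕ) y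
          (fun j => ((Fin.consEquiv fun _ : Fin (n + 1) => Fin m) (x, g) j : ℕ)) i.castSucc)
          ((Fin.consEquiv fun _ : Fin (n + 1) => Fin m) (x, g) i) then 1 else 0) =
        if IsStep (d 0) y x then walks n (fun i => d (i + 1)) x else 0 := by
      intro x
      split_ifs with hx
      · rw [ih _ _ x.2]
        refine Finset.sum_congr rfl fun g _ => ?_
        refine if_congr ?_ rfl rfl
        rw [Fin.forall_fin_succ]
        simp only [Fin.castSucc_zero, Fin.cons_zero, Fin.consEquiv, Equiv.coe_fn_mk,
          Fin.val_zero, hx, true_and, Fin.val_succ, Fin.cons_succ]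
        refine forall_congr' fun i => ?_
        refine iff_of_eq (congrArg (fun t => IsStep _ t _) ?_)
        rcases i with ⟨_ | i, hi⟩ <;> rfl
      · refine Finset.sum_eq_zero fun g _ => if_neg fun h => hx ?_
        simpa [Fin.consEquiv] using h 0
    rw [Finset.sum_congr rfl fun x _ => h1 x,
      Fin.sum_univ_eq_sum_range
        (fun x => if IsStep (d 0) y x then walks n (fun i => d (i + 1)) x else 0) m,
      ← Finset.sum_subset (Finset.range_subset_range.mpr (Nat.succ_le_of_lt hy)),
      Finset.sum_range_succ, walks]
    · congr 1
      · refine Finset.sum_congr rfl fun x hx => ?_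
        exact (if_pos (Or.inl (Finset.mem_range.mp hx))).symm
      · simp [IsStep]
    · intro x _ hx
      rw [if_neg]
      simp only [Finset.mem_range, IsStep] at hx ⊢
      omega

theorem word_succ {n : ℕ} (σ : Equiv.Perm (Fin n)) {i : ℕ} (h : i < n) :
    word σ (i + 1) = σ ⟨i, h⟩ + 1 := by simp [word, h]

/-- The walk is the list of values of `f` in the order `σ`; ties at even values need an ascent, ties
at odd values a descent. The extra step from `M` to the first value is unconstrained because `h0`
permits staying at `M`. Thus `d 0` reflects the parity of `M`, not `σ`. -/
theorem sortCount_eq_walks {n M : ℕ} (σ : Equiv.Perm (Fin n)) (d : ℕ → Bool)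
    (hd : ∀ i, 1 ≤ i → d i = decide (word σ (i + 1) < word σ i))
    (h0 : Even M ↔ d 0 = false) : sortCount (M + 1) σ = walks n d M := by
  classical
  rw [walks_eq_sum (M + 1) n d M (Nat.lt_succ_self M), sortCount, Fintype.card_subtype,
    Finset.card_filter]
  refine Fintype.sum_equiv (Equiv.arrowCongr σ.symm (Equiv.refl _)) _ _ fun f => ?_
  refine if_congr ?_ rfl rfl
  have hg : ∀ i, Equiv.arrowCongr σ.symm (Equiv.refl (Fin (M + 1))) f i = f (σ i) := fun i => rfl
  simp only [hg]
  rcases n with _ | n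
  · simp [Sorts, StrictMono]
  · rw [Sorts, Fin.strictMono_iff_lt_succ, Fin.forall_fin_succ (P := fun i => IsStep _ _ _)]
    have hfirst : IsStep (d 0) M (f (σ 0)) := by
      rcases (Nat.lt_succ_iff.mp (f (σ 0)).2).lt_or_eq with h | h
      · exact Or.inl h
      · exact Or.inr ⟨h, h0⟩
    simp only [Fin.castSucc_zero, Fin.cons_zero, Fin.val_zero, hfirst, true_and]
    refine forall_congr' fun i => ?_
    have hc : (Fin.cons (α := fun _ => ℕ) M (fun j => (f (σ j) : ℕ)) i.succ.castSucc : ℕ) =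
        f (σ i.castSucc) := by
      rw [← Fin.succ_castSucc, Fin.cons_succ]
    rw [hc, Function.comp_apply, Function.comp_apply, sortKey_lt_iff, IsStep]
    refine or_congr Iff.rfl ?_
    rw [Fin.val_inj, eq_comm]
    refine and_congr_right fun h => ?_
    rw [hd _ (by simp), Fin.val_succ, word_succ σ (show (i : ℕ) + 1 < n + 1 by omega),
      word_succ σ (show (i : ℕ) < n + 1 by omega)]
    have hne : σ i.castSucc ≠ σ i.succ := fun h => by
      have := congrArg Fin.val (σ.injective h)
      simp at this
    have e1 : (⟨(i : ℕ) + 1, by omega⟩ : Fin (n + 1)) = i.succ := rfl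
    have e2 : (⟨(i : ℕ), by omega⟩ : Fin (n + 1)) = i.castSucc := rfl
    rw [e1, e2]
    have h3 : σ i.castSucc < σ i.succ ↔ ¬ (σ i.succ < σ i.castSucc) := by
      rw [not_lt]; exact ⟨le_of_lt, fun h => lt_of_le_of_ne h hne⟩
    by_cases he : Even (f (σ i.castSucc) : ℕ) <;> simp [he, h3]

/-- The number of changes from `false` to `true` in `d 0, …, d (n - 1)`. -/
def changes (n : ℕ) (d : ℕ → Bool) : ℕ :=
  ∑ i ∈ Finset.range (n - 1), if d i = false ∧ d (i + 1) = true then 1 else 0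

theorem changes_add_two (n : ℕ) (d : ℕ → Bool) :
    changes (n + 2) d = changes (n + 1) (fun i => d (i + 1)) +
      if d 0 = false ∧ d 1 = true then 1 else 0 := by
  rw [changes, changes, Nat.add_sub_cancel, show n + 2 - 1 = n + 1 by omega,
    Finset.sum_range_succ']

theorem word_ne {n : ℕ} (σ : Equiv.Perm (Fin n)) {i : ℕ} (hi : i < n) :
    word σ i ≠ word σ (i + 1) := by
  rw [word_succ σ hi]
  rcases i with _ | i
  · simp [word]
  · rw [word_succ σ (by omega : i < n)]
    simp [Fin.val_inj]

theorem changes_descents {n : ℕ} (σ : Equiv.Perm (Fin n)) :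
    changes n (fun i => decide (word σ (i + 1) < word σ i)) = (peak σ).card := by
  rw [peak, Finset.card_filter, show Finset.Icc 1 (n - 1) = Finset.Ico 1 n by
    ext; simp; omega, Finset.sum_Ico_eq_sum_range, changes]
  refine Finset.sum_congr rfl fun i hi => if_congr ?_ rfl rfl
  have hi : i + 1 < n := by have := Finset.mem_range.mp hi; omega
  have := word_ne σ (show i < n by omega)
  simp only [decide_eq_false_iff_not, decide_eq_true_eq, add_comm 1 i, Nat.add_sub_cancel]
  omega

/-- Declaring a descent at position 0 destroys only the change that records the peak 1. -/
theorem changes_descents_update {n : ℕ} (σ : Equiv.Perm (Fin n)) :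
    changes n (Function.update (fun i => decide (word σ (i + 1) < word σ i)) 0 true) =
      (peak σ \ {1}).card := by
  rw [peak, Finset.sdiff_singleton_eq_erase, ← Finset.filter_ne', Finset.filter_filter,
    Finset.card_filter, show Finset.Icc 1 (n - 1) = Finset.Ico 1 n by
    ext; simp; omega, Finset.sum_Ico_eq_sum_range, changes]
  refine Finset.sum_congr rfl fun i hi => if_congr ?_ rfl rfl
  have hi : i + 1 < n := by have := Finset.mem_range.mp hi; omega
  rcases i with _ | i
  · simp
  · have := word_ne σ (show i + 1 < n by omega)
    simp only [Function.update_apply, decide_eq_false_iff_not, decide_eq_true_eq,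
      add_comm 1 (i + 1), Nat.add_sub_cancel, Nat.add_eq_zero_iff, one_ne_zero, and_false, if_false]
    omega

/-! ### Generating functions of walks -/

open PowerSeries

theorem one_sub_X_mul_mk (f g : ℕ → ℚ) (h0 : f 0 = g 0) (h : ∀ b, f (b + 1) = f b + g (b + 1)) :
    (1 - X) * mk f = mk g := by
  ext b
  rcases b with _ | b
  · simp [sub_mul, h0]
  · simp [sub_mul, coeff_succ_X_mul, h]

/-- Values at neighbouring arguments agree in pairs, so even arguments suffice. Multiplication by `1
- X` turns the recursion into a factor: `1 + X` if the first two steps have the same kind, `2` for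
ascent then descent, `2 * X` for descent then ascent. -/
theorem walks_generating (n : ℕ) (d : ℕ → Bool) :
    ((n = 0 ∨ d 0 = false) → ∃ e, e + 2 * changes n d = n ∧
      (∀ b, walks n d (2 * b + 1) = walks n d (2 * b)) ∧
      (1 - X) ^ (n + 1) * mk (fun b => (walks n d (2 * b) : ℚ)) =
        (4 * X) ^ changes n d * (1 + X) ^ e) ∧
    (n ≠ 0 → d 0 = true → ∃ e, e + 2 * changes n d + 1 = n ∧
      walks n d 0 = 0 ∧ (∀ b, walks n d (2 * b + 2) = walks n d (2 * b + 1)) ∧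
      (1 - X) ^ (n + 1) * mk (fun b => (walks n d (2 * b) : ℚ)) =
        2 * X * (4 * X) ^ changes n d * (1 + X) ^ e) := by
  induction n generalizing d with
  | zero =>
    refine ⟨fun _ => ⟨0, by simp [changes], fun b => by simp [walks], ?_⟩, fun h => absurd rfl h⟩
    simp only [walks, changes]
    have := mk_one_mul_one_sub_eq_one ℚ
    simp only [zero_add, pow_one, Nat.cast_one, Finset.range_zero, Finset.sum_empty, pow_zero,
      mul_one, zero_tsub]
    rw [mul_comm]
    exact this
  | succ n ih =>
    set d' : ℕ → Bool := fun i => d (i + 1) with hd'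
    obtain ⟨ihA, ihD⟩ := ih d'
    have hW : ∀ y, walks (n + 1) d y = ∑ x ∈ Finset.range y, walks n d' x +
      if Even y ↔ d 0 = false then walks n d' y else 0 := fun y => rfl
    -- The empty walk behaves as if an ascent came next.
    have hstate : (n = 0 ∨ d' 0 = false) ∨ (n ≠ 0 ∧ d' 0 = true) := by
      cases d' 0 <;> simp [em]
    have hev : ∀ b, Even (2 * b) := even_two_mul
    have hod : ∀ b, ¬ Even (2 * b + 1) := fun b => by simp
    have hev2 : ∀ b, Even (2 * b + 2) := fun b => even_two_mul (b + 1)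
    constructor
    · intro h
      replace h : d 0 = false := by simpa using h
      have w1 : ∀ b, walks (n + 1) d (2 * b + 1) = walks (n + 1) d (2 * b) := fun b => by
        simp [hW, h, hod, Finset.sum_range_succ]
      have w2 : ∀ b, walks (n + 1) d (2 * b + 2) =
          walks (n + 1) d (2 * b) + walks n d' (2 * b + 1) + walks n d' (2 * b + 2) := fun b => by
        rw [hW, hW]
        simp [h, hev2, Finset.sum_range_succ]
      have w0 : walks (n + 1) d 0 = walks n d' 0 := by simp [hW, h]
      rcases hstate with hs | ⟨hn, hs⟩
      · obtain ⟨e, he, hc, hgf⟩ := ihA hs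
        have hch : changes (n + 1) d = changes n d' := by
          rcases n with _ | n
          · simp [changes]
          · rw [changes_add_two]
            have : d 1 = false := by simpa using hs
            simp [this, hd']
        refine ⟨e + 1, by omega, w1, ?_⟩
        have key : (1 - X) * mk (fun b => (walks (n + 1) d (2 * b) : ℚ)) =
            (1 + X) * mk (fun b => (walks n d' (2 * b) : ℚ)) := by
          have : (1 + X) * mk (fun b => (walks n d' (2 * b) : ℚ)) =
              mk (fun b => (walks (n + 1) d (2 * b) : ℚ) -
                if b = 0 then 0 else (walks (n + 1) d (2 * (b - 1)) : ℚ)) := by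
            ext b
            rcases b with _ | b
            · simp [add_mul, w0]
            · simp [add_mul, coeff_succ_X_mul, mul_add, w2, hc]
              ring
          rw [this]
          exact one_sub_X_mul_mk _ _ (by simp) fun b => by simp
        rw [pow_succ, mul_assoc, key, hch, pow_succ (1 + X) e, ← mul_assoc _ _ (1 + X), ← hgf]
        ring
      · obtain ⟨e, he, hz, hc, hgf⟩ := ihD hn hs
        have hch : changes (n + 1) d = changes n d' + 1 := by
          obtain ⟨n, rfl⟩ := Nat.exists_eq_succ_of_ne_zero hn
          rw [changes_add_two]
          have : d 1 = true := hs
          simp [this, h, hd']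
        refine ⟨e, by omega, w1, ?_⟩
        have key : (1 - X) * mk (fun b => (walks (n + 1) d (2 * b) : ℚ)) =
            2 * mk (fun b => (walks n d' (2 * b) : ℚ)) := by
          have : 2 * mk (fun b => (walks n d' (2 * b) : ℚ)) =
              mk (fun b => 2 * (walks n d' (2 * b) : ℚ)) := by
            ext b
            rw [← map_ofNat (C (R := ℚ)) 2, coeff_C_mul]
            simp
          rw [this]
          refine one_sub_X_mul_mk _ _ (by simp [w0, hz]) fun b => ?_
          simp only [mul_add, mul_one, w2, hc]
          push_cast
          ring
        rw [pow_succ, mul_assoc, key, hch, pow_succ,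
          show (4 : ℚ⟦X⟧) * X = 2 * (2 * X) by ring]
        rw [show (4 : ℚ⟦X⟧) * X = 2 * (2 * X) by ring] at hgf
        linear_combination 2 * hgf
    · intro _ h
      have w1 : ∀ b, walks (n + 1) d (2 * b + 2) = walks (n + 1) d (2 * b + 1) := fun b => by
        simp [hW, h, hod, hev2, Finset.sum_range_succ]
      have w2 : ∀ b, walks (n + 1) d (2 * b + 2) =
          walks (n + 1) d (2 * b) + walks n d' (2 * b) + walks n d' (2 * b + 1) := fun b => by
        rw [hW, hW]
        simp [h, hev2, Finset.sum_range_succ]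
      have w0 : walks (n + 1) d 0 = 0 := by simp [hW, h]
      have hch : changes (n + 1) d = changes n d' := by
        rcases n with _ | n
        · simp [changes]
        · rw [changes_add_two]
          simp [h, hd']
      rcases hstate with hs | ⟨hn, hs⟩
      · obtain ⟨e, he, hc, hgf⟩ := ihA hs
        refine ⟨e, by omega, w0, w1, ?_⟩
        have key : (1 - X) * mk (fun b => (walks (n + 1) d (2 * b) : ℚ)) =
            2 * X * mk (fun b => (walks n d' (2 * b) : ℚ)) := by
          have : 2 * X * mk (fun b => (walks n d' (2 * b) : ℚ)) =
              mk (fun b => if b = 0 then 0 else 2 * (walks n d' (2 * (b - 1)) : ℚ)) := by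
            ext b
            rw [← map_ofNat (C (R := ℚ)) 2, mul_assoc, coeff_C_mul]
            rcases b with _ | b
            · simp
            · simp [coeff_succ_X_mul]
          rw [this]
          refine one_sub_X_mul_mk _ _ (by simp [w0]) fun b => ?_
          simp only [mul_add, mul_one, w2, hc]
          simp
          ring
        rw [pow_succ, mul_assoc, key, hch]
        linear_combination 2 * X * hgf
      · obtain ⟨e, he, hz, hc, hgf⟩ := ihD hn hs
        refine ⟨e + 1, by omega, w0, w1, ?_⟩
        have key : (1 - X) * mk (fun b => (walks (n + 1) d (2 * b) : ℚ)) =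
            (1 + X) * mk (fun b => (walks n d' (2 * b) : ℚ)) := by
          have : (1 + X) * mk (fun b => (walks n d' (2 * b) : ℚ)) =
              mk (fun b => (walks (n + 1) d (2 * b) : ℚ) -
                if b = 0 then 0 else (walks (n + 1) d (2 * (b - 1)) : ℚ)) := by
            ext b
            rcases b with _ | b
            · simp [add_mul, w0, hz]
            · simp [add_mul, coeff_succ_X_mul, mul_add, w2, hc]
              ring
          rw [this]
          exact one_sub_X_mul_mk _ _ (by simp) fun b => by simp
        rw [pow_succ, mul_assoc, key, hch, pow_succ (1 + X) e]
        linear_combination (1 + X) * hgf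

end Walks

/-! ### Interpolating the multiplication rule -/

section Interpolation

open Polynomial Filter

theorem polynomial_eq_of_eventually {p q : ℚ[X]}
    (h : ∀ᶠ a : ℕ in atTop, p.eval (a : ℚ) = q.eval (a : ℚ)) : p = q := by
  obtain ⟨N, hN⟩ := eventually_atTop.mp h
  refine eq_of_infinite_eval_eq p q (((Set.Ici_infinite N).image
    (Nat.cast_injective (R := ℚ)).injOn).mono ?_)
  rintro _ ⟨a, ha, rfl⟩
  exact hN a ha

/-- A convolution identity between polynomials that holds at large integers holds everywhere. -/
theorem convolution_eval_eq {G : Type*} [Group G] [Fintype G] (P : G → ℚ[X]) (β : ℚ)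
    (h : ∀ᶠ a : ℕ in atTop, ∀ᶠ b : ℕ in atTop, ∀ x,
      ∑ y, (P y).eval (a : ℚ) * (P (y⁻¹ * x)).eval (b : ℚ) =
        (P x).eval (2 * a * b + β * (a + b) : ℚ)) (s t : ℚ) (x : G) :
    ∑ y, (P y).eval s * (P (y⁻¹ * x)).eval t = (P x).eval (2 * s * t + β * (s + t)) := by
  have h1 : ∀ᶠ a : ℕ in atTop, ∑ y, (P y).eval (a : ℚ) * (P (y⁻¹ * x)).eval t =
      (P x).eval (2 * a * t + β * (a + t) : ℚ) := by
    filter_upwards [h] with a ha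
    have : ∑ y, C ((P y).eval (a : ℚ)) * P (y⁻¹ * x) =
        (P x).comp (C (2 * a + β : ℚ) * X + C (β * a : ℚ)) := by
      refine polynomial_eq_of_eventually ?_
      filter_upwards [ha] with b hb
      simp only [eval_finsetSum, eval_mul, eval_C, hb, eval_comp, eval_add, eval_X]
      ring_nf
    have := congrArg (eval t) this
    simp only [eval_finsetSum, eval_mul, eval_C, eval_comp, eval_add, eval_X] at this
    rw [this]
    ring_nf
  have : ∑ y, P y * C ((P (y⁻¹ * x)).eval t) =
      (P x).comp (C (2 * t + β : ℚ) * X + C (β * t : ℚ)) := by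
    refine polynomial_eq_of_eventually ?_
    filter_upwards [h1] with a ha
    simp only [eval_finsetSum, eval_mul, eval_C, ha, eval_comp, eval_add, eval_X]
    ring_nf
  have := congrArg (eval s) this
  simp only [eval_finsetSum, eval_mul, eval_C, eval_comp, eval_add, eval_X] at this
  rw [this]
  ring_nf

/-- This is the mixed derivative of P(s) P(t) = P(2st) at s = t = 0. -/
theorem convolution_derivative_eq {G : Type*} [Group G] [Fintype G] (P : G → ℚ[X])
    (h : ∀ s t x, ∑ y, (P y).eval s * (P (y⁻¹ * x)).eval t = (P x).eval (2 * s * t)) (x : G) :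
    ∑ y, (derivative (P y)).eval 0 * (derivative (P (y⁻¹ * x))).eval 0 =
      2 * (derivative (P x)).eval 0 := by
  have h1 : ∀ t, ∑ y, (derivative (P y)).eval 0 * (P (y⁻¹ * x)).eval t =
      2 * t * (derivative (P x)).eval 0 := by
    intro t
    have : ∑ y, P y * C ((P (y⁻¹ * x)).eval t) = (P x).comp (C (2 * t) * X) := by
      refine funext fun s => ?_
      simp only [eval_finsetSum, eval_mul, eval_C, h, eval_comp, eval_X]
      ring_nf
    have := congrArg (fun p => eval 0 (derivative p)) this
    simpa [eval_finsetSum, derivative_comp] using this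
  have : ∑ y, C ((derivative (P y)).eval 0) * P (y⁻¹ * x) =
      C (2 * (derivative (P x)).eval 0) * X := by
    refine funext fun t => ?_
    simp only [eval_finsetSum, eval_mul, eval_C, h1, eval_X]
    ring
  have := congrArg (fun p => eval 0 (derivative p)) this
  simpa [eval_finsetSum] using this

theorem eventually_eq_hilbertPoly {n : ℕ} {f : ℕ → ℚ} {p : ℚ[X]}
    (h : (1 - PowerSeries.X) ^ (n + 1) * PowerSeries.mk f = (p : PowerSeries ℚ)) :
    ∀ᶠ a : ℕ in atTop, f a = (hilbertPoly p (n + 1)).eval (a : ℚ) := by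
  filter_upwards [eventually_gt_atTop p.natDegree] with a ha
  rw [← coeff_mul_invOneSubPow_eq_hilbertPoly_eval (n + 1) ha, ← h, mul_comm, ← mul_assoc]
  have : ((PowerSeries.invOneSubPow ℚ (n + 1) : (PowerSeries ℚ)ˣ) : PowerSeries ℚ) *
      (1 - PowerSeries.X) ^ (n + 1) = 1 := by
    rw [← PowerSeries.invOneSubPow_inv_eq_one_sub_pow]
    exact (PowerSeries.invOneSubPow ℚ (n + 1)).val_inv
  rw [this, one_mul, PowerSeries.coeff_mk]

/-- The polynomial in `a` counting the functions into `Fin (2 * a + 1)` that are sorted by a given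
permutation with `j` peaks. -/
noncomputable def oddPoly (n j : ℕ) : ℚ[X] :=
  hilbertPoly ((4 : ℚ) ^ j • (X ^ j * (1 + X) ^ (n - 2 * j))) (n + 1)

/-- The polynomial in `a` counting the functions into `Fin (2 * a)` that are sorted by a given
permutation with `j` interior peaks. -/
noncomputable def evenPoly (n j : ℕ) : ℚ[X] :=
  hilbertPoly ((2 * 4 ^ j : ℚ) • (X * (X ^ j * (1 + X) ^ (n - 1 - 2 * j)))) (n + 1)

theorem sortCount_odd {n : ℕ} (σ : Equiv.Perm (Fin n)) :
    2 * (peak σ).card ≤ n ∧ ∀ᶠ a : ℕ in atTop,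
      (sortCount (2 * a + 1) σ : ℚ) = (oddPoly n (peak σ).card).eval (a : ℚ) := by
  set d : ℕ → Bool := fun i => decide (word σ (i + 1) < word σ i) with hd
  have hd0 : d 0 = false := by simp [hd, word]
  obtain ⟨e, he, -, hgf⟩ := (walks_generating n d).1 (Or.inr hd0)
  rw [changes_descents] at he hgf
  refine ⟨by omega, ?_⟩
  have := eventually_eq_hilbertPoly (p := (4 : ℚ) ^ (peak σ).card •
    (X ^ (peak σ).card * (1 + X) ^ (n - 2 * (peak σ).card))) (hgf.trans (by
      rw [show n - 2 * (peak σ).card = e by omega, smul_eq_C_mul]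
      push_cast
      rw [mul_pow, mul_assoc, map_pow, map_ofNat]))
  filter_upwards [this] with a ha
  rw [sortCount_eq_walks σ d (fun i _ => rfl) (by simp [hd0]), oddPoly, ← ha]

theorem sortCount_even {n : ℕ} (hn : n ≠ 0) (σ : Equiv.Perm (Fin n)) :
    2 * (peak σ \ {1}).card + 1 ≤ n ∧ ∀ᶠ a : ℕ in atTop,
      (sortCount (2 * a) σ : ℚ) = (evenPoly n (peak σ \ {1}).card).eval (a : ℚ) := by
  set d : ℕ → Bool :=
    Function.update (fun i => decide (word σ (i + 1) < word σ i)) 0 true with hd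
  have hd0 : d 0 = true := by simp [hd]
  obtain ⟨e, he, -, hw, hgf⟩ := (walks_generating n d).2 hn hd0
  rw [changes_descents_update] at he hgf
  refine ⟨by omega, ?_⟩
  have := eventually_eq_hilbertPoly (p := (2 * 4 ^ (peak σ \ {1}).card : ℚ) •
    (X * (X ^ (peak σ \ {1}).card * (1 + X) ^ (n - 1 - 2 * (peak σ \ {1}).card))))
    (hgf.trans (by
      rw [show n - 1 - 2 * (peak σ \ {1}).card = e by omega, smul_eq_C_mul]
      push_cast
      rw [mul_pow, map_mul, map_pow, map_ofNat, map_ofNat]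
      ring))
  filter_upwards [this, eventually_ge_atTop 1] with a ha h1
  obtain ⟨b, rfl⟩ := Nat.exists_eq_add_of_le' h1
  -- The walk starts at the odd height `2 * b + 1`; `hw` moves it to `2 * b + 2`, where the
  -- generating function applies.
  rw [show 2 * (b + 1) = (2 * b + 1) + 1 by ring,
    sortCount_eq_walks (M := 2 * b + 1) σ d (fun i hi => by
      rw [hd, Function.update_of_ne (by omega)]) (by simp [hd0]), evenPoly, ← ha, ← hw]
  rfl

theorem oddPoly_convolution {n : ℕ} (s t : ℚ) (π : Equiv.Perm (Fin n)) :
    ∑ σ : Equiv.Perm (Fin n), (oddPoly n (peak σ).card).eval s *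
      (oddPoly n (peak (σ⁻¹ * π)).card).eval t =
      (oddPoly n (peak π).card).eval (2 * s * t + 1 * (s + t)) := by
  refine convolution_eval_eq (fun σ : Equiv.Perm (Fin n) => oddPoly n (peak σ).card) 1 ?_ s t π
  have hall : ∀ᶠ a : ℕ in atTop, ∀ σ : Equiv.Perm (Fin n),
      (sortCount (2 * a + 1) σ : ℚ) = (oddPoly n (peak σ).card).eval (a : ℚ) :=
    eventually_all.mpr fun σ => (sortCount_odd σ).2
  obtain ⟨N, hN⟩ := eventually_atTop.mp hall
  filter_upwards [eventually_ge_atTop N] with a ha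
  filter_upwards [eventually_ge_atTop N] with b hb x
  have hab : N ≤ 2 * a * b + (a + b) := by omega
  have h1 := hN _ hab x
  push_cast at h1
  rw [one_mul, ← h1, show 2 * (2 * a * b + (a + b)) + 1 = (2 * b + 1) * (2 * a + 1) by ring,
    ← sum_sortCount_mul, Nat.cast_sum]
  refine Finset.sum_congr rfl fun σ _ => ?_
  rw [Nat.cast_mul, hN a ha, hN b hb]

theorem evenPoly_convolution {n : ℕ} (hn : n ≠ 0) (s t : ℚ) (π : Equiv.Perm (Fin n)) :
    ∑ σ : Equiv.Perm (Fin n), (evenPoly n (peak σ \ {1}).card).eval s *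
      (evenPoly n (peak (σ⁻¹ * π) \ {1}).card).eval t =
      (evenPoly n (peak π \ {1}).card).eval (2 * s * t) := by
  have h := convolution_eval_eq (fun σ : Equiv.Perm (Fin n) => evenPoly n (peak σ \ {1}).card) 0
    ?_ s t π
  · simpa using h
  have hall : ∀ᶠ a : ℕ in atTop, ∀ σ : Equiv.Perm (Fin n),
      (sortCount (2 * a) σ : ℚ) = (evenPoly n (peak σ \ {1}).card).eval (a : ℚ) :=
    eventually_all.mpr fun σ => (sortCount_even hn σ).2
  obtain ⟨N, hN⟩ := eventually_atTop.mp hall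
  filter_upwards [eventually_ge_atTop N] with a ha
  -- The bound `N + 1` makes `b` positive, so that `2 * a * b ≥ N`.
  filter_upwards [eventually_ge_atTop (N + 1)] with b hb x
  have hab : N ≤ 2 * a * b := by nlinarith
  have h1 := hN _ hab x
  push_cast at h1
  rw [zero_mul, add_zero, ← h1, show 2 * (2 * a * b) = (2 * b) * (2 * a) by ring,
    ← sum_sortCount_mul, Nat.cast_sum]
  refine Finset.sum_congr rfl fun σ _ => ?_
  rw [Nat.cast_mul, hN a ha, hN b (by omega)]

end Interpolation

/-! ### Tools for evaluating the interpolating polynomials -/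

section Values

open Polynomial

/-- A functional on polynomials satisfying a first-order recurrence on monomials annihilates the
image of a first-order differential operator. -/
theorem apply_operator_eq_zero (L : ℚ[X] →ₗ[ℚ] ℚ) (d : ℕ) (u : ℚ)
    (hL : ∀ s < d, (d - 1 - s + u : ℚ) * L (X ^ (s + 1)) = -(s + u) * L (X ^ s))
    (F : ℚ[X]) (hF : F.natDegree < d) :
    L (X * (((d : ℚ) - 1 + u) • F - X * derivative F) + X * derivative F + u • F) = 0 := by
  let Φ : ℚ[X] →ₗ[ℚ] ℚ := L ∘ₗ
    (LinearMap.mulLeft ℚ X ∘ₗ (((d : ℚ) - 1 + u) • LinearMap.id -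
      LinearMap.mulLeft ℚ X ∘ₗ derivative) + LinearMap.mulLeft ℚ X ∘ₗ derivative +
      u • LinearMap.id)
  have hΦ : ∀ F, Φ F = L (X * (((d : ℚ) - 1 + u) • F - X * derivative F) + X * derivative F +
    u • F) := fun F => rfl
  rw [← hΦ, F.as_sum_range' d hF, map_sum]
  refine Finset.sum_eq_zero fun s hs => ?_
  rw [← C_mul_X_pow_eq_monomial, ← smul_eq_C_mul, map_smul, hΦ]
  have hX : X * derivative (X ^ s : ℚ[X]) = (s : ℚ) • X ^ s := by
    rcases s with _ | s
    · simp
    · rw [derivative_X_pow, smul_eq_C_mul, pow_succ]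
      simp
      ring
  have : X * (((d : ℚ) - 1 + u) • X ^ s - X * derivative (X ^ s)) + X * derivative (X ^ s) +
      u • X ^ s = (d - 1 - s + u : ℚ) • X ^ (s + 1) + (s + u : ℚ) • (X ^ s : ℚ[X]) := by
    rw [hX, pow_succ]
    simp only [smul_eq_C_mul, map_add, map_sub]
    ring
  rw [this, map_add, map_smul, map_smul, smul_eq_mul, smul_eq_mul, hL s (Finset.mem_range.mp hs), neg_mul,
    smul_eq_mul, neg_add_cancel, mul_zero]

theorem apply_X_pow_mul_one_add_X_pow (L : ℚ[X] →ₗ[ℚ] ℚ) (i e : ℕ) (u : ℚ)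
    (hL : ∀ s < 2 * i + e + 2,
      ((2 * i + e + 2 : ℕ) - 1 - s + u : ℚ) * L (X ^ (s + 1)) = -(s + u) * L (X ^ s)) :
    (e + 1 : ℚ) * (4 ^ (i + 1) * L (X ^ (i + 1) * (1 + X) ^ e)) =
      -(2 * (i + u)) * (4 ^ i * L (X ^ i * (1 + X) ^ (e + 2))) := by
  -- For this `F` and d = 2i + e + 2 the operator leaves just two terms, multiples of the numerators
  -- for `i` and `i + 1` peaks.
  have h := apply_operator_eq_zero L _ u hL (X ^ i * (1 + X) ^ (e + 1)) (by
    refine (natDegree_mul_le.trans (add_le_add (natDegree_X_pow_le i)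
      (natDegree_pow_le.trans (Nat.mul_le_mul_left (e + 1) (?_ : _ ≤ 1))))).trans_lt ?_
    · exact (natDegree_add_le _ _).trans (by simp)
    · omega)
  have hX : X * derivative (X ^ i * (1 + X) ^ (e + 1) : ℚ[X]) =
      (C (i : ℚ) * (1 + X) + C (e + 1 : ℚ) * X) * (X ^ i * (1 + X) ^ e) := by
    have h1 : X * derivative (X ^ i : ℚ[X]) = C (i : ℚ) * X ^ i := by
      rcases i with _ | i
      · simp
      · rw [derivative_X_pow, pow_succ]
        simp
        ring
    rw [derivative_mul, mul_add, ← mul_assoc, h1]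
    simp [derivative_pow]
    ring
  have heq : X * ((((2 * i + e + 2 : ℕ) : ℚ) - 1 + u) • (X ^ i * (1 + X) ^ (e + 1)) -
      X * derivative (X ^ i * (1 + X) ^ (e + 1))) +
      X * derivative (X ^ i * (1 + X) ^ (e + 1)) + u • (X ^ i * (1 + X) ^ (e + 1)) =
      (i + u : ℚ) • (X ^ i * (1 + X) ^ (e + 2)) +
        (2 * (e + 1) : ℚ) • (X ^ (i + 1) * (1 + X) ^ e : ℚ[X]) := by
    rw [hX]
    simp only [smul_eq_C_mul]
    push_cast
    simp only [map_add, map_sub, map_mul, map_natCast, map_ofNat, map_one]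
    ring
  rw [heq, map_add, map_smul, map_smul, smul_eq_mul, smul_eq_mul] at h
  rw [pow_succ]
  linear_combination 2 * 4 ^ i * h

/-- `preHilbertPoly ℚ n s` is the binomial coefficient of X - s + n over n; consecutive ones share
all but one linear factor. -/
theorem preHilbertPoly_succ (n s : ℕ) :
    (X - C (s : ℚ) + C (n : ℚ)) * preHilbertPoly ℚ n (s + 1) =
      (X - C (s : ℚ)) * preHilbertPoly ℚ n s := by
  have h1 : (ascPochhammer ℚ (n + 1)).comp (X - C (s : ℚ)) =
      (X - C (s : ℚ)) * (ascPochhammer ℚ n).comp (X - C (s : ℚ) + 1) := by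
    rw [ascPochhammer_succ_left, mul_comp, X_comp, comp_assoc]
    simp
  have h2 : (ascPochhammer ℚ (n + 1)).comp (X - C (s : ℚ)) =
      (ascPochhammer ℚ n).comp (X - C (s : ℚ)) * (X - C (s : ℚ) + C (n : ℚ)) := by
    rw [ascPochhammer_succ_right, mul_comp]
    simp
  rw [preHilbertPoly, preHilbertPoly, mul_smul_comm, mul_smul_comm, ← h1, h2]
  push_cast
  rw [map_add, map_one, show (X - (C (s : ℚ) + 1) + 1 : ℚ[X]) = X - C (s : ℚ) by ring, mul_comm]

theorem ascPochhammer_comp_add_two (k : ℕ) (p : ℚ[X]) :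
    (ascPochhammer ℚ (k + 2)).comp p =
      p * (ascPochhammer ℚ k).comp (p + 1) * (p + 1 + (k : ℚ[X])) := by
  rw [ascPochhammer_succ_left, mul_comp, X_comp, comp_assoc, ascPochhammer_succ_right, mul_comp]
  simp [mul_assoc]

/-- The factors run from 1/2 - m to m - 1/2; the outermost pair is peeled off at each step. -/
theorem ascPochhammer_eval_half (m : ℕ) :
    4 ^ m * (ascPochhammer ℚ (2 * m)).eval (1 / 2 - m : ℚ) =
      (-1) ^ m * (((2 * m - 1)‼ : ℕ) : ℚ) ^ 2 := by
  induction m with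
  | zero => simp
  | succ m ih =>
    have h := congrArg (eval 0) (ascPochhammer_comp_add_two (2 * m) (C (1 / 2 - (m + 1) : ℚ)))
    simp only [eval_comp, eval_mul, eval_C, eval_add, eval_one, eval_natCast] at h
    have hd : (2 * (m + 1) - 1)‼ = (2 * m + 1) * (2 * m - 1)‼ := by
      rcases m with _ | m
      · rfl
      · exact Nat.doubleFactorial_add_two (2 * m + 1)
    rw [show 2 * (m + 1) = 2 * m + 2 by ring] at hd ⊢
    push_cast at h ⊢
    rw [show 2 * m + 1 = 2 * m + 2 - 1 by omega, hd, h, show (1 / 2 - (m + 1) + 1 : ℚ) = 1 / 2 - m by ring, pow_succ (-1 : ℚ)]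
    push_cast
    linear_combination (-(2 * m + 1 : ℚ) ^ 2) * ih

/-- The polynomial is X times the product of X² - i² for 1 ≤ i ≤ h. -/
theorem derivative_ascPochhammer_comp (h : ℕ) :
    (derivative ((ascPochhammer ℚ (2 * h + 1)).comp (X - C (h : ℚ)))).eval 0 =
      (-1) ^ h * ((h ! : ℕ) : ℚ) ^ 2 := by
  induction h with
  | zero => simp
  | succ h ih =>
    have e : (ascPochhammer ℚ (2 * (h + 1) + 1)).comp (X - C ((h + 1 : ℕ) : ℚ)) =
        (X ^ 2 - C (((h : ℚ) + 1) ^ 2)) *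
          (ascPochhammer ℚ (2 * h + 1)).comp (X - C (h : ℚ)) := by
      rw [show 2 * (h + 1) + 1 = (2 * h + 1) + 2 by ring, ascPochhammer_comp_add_two]
      push_cast
      rw [map_add, map_one, show (X - (C (h : ℚ) + 1) + 1 : ℚ[X]) = X - C (h : ℚ) by ring]
      simp only [map_pow, map_add, map_natCast, map_one]
      ring
    rw [e, derivative_mul, eval_add, eval_mul, eval_mul, ih, Nat.factorial_succ, derivative_sub,
      derivative_C, derivative_X_pow]
    simp
    ring

end Values

/-! ### The interpolated values are the coefficients of ρ -/

section Values

open Polynomial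

theorem rhoCoeff_succ {m j : ℕ} (hj : j < m) :
    (2 * m - 2 * j - 1 : ℚ) * rhoCoeff (2 * m) (j + 1) =
      -(2 * j + 1) * rhoCoeff (2 * m) j := by
  obtain ⟨t, rfl⟩ := Nat.exists_eq_add_of_lt hj
  have h1 : (2 * (j + 1) - 1)‼ = (2 * j + 1) * (2 * j - 1)‼ := by
    rcases j with _ | j
    · rfl
    · exact Nat.doubleFactorial_add_two (2 * j + 1)
  have h2 : (2 * (j + t + 1) - 2 * j - 1)‼ =
      (2 * t + 1) * (2 * (j + t + 1) - 2 * (j + 1) - 1)‼ := by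
    rw [show 2 * (j + t + 1) - 2 * j - 1 = 2 * t + 1 by omega,
      show 2 * (j + t + 1) - 2 * (j + 1) - 1 = 2 * t - 1 by omega]
    rcases t with _ | t
    · rfl
    · exact Nat.doubleFactorial_add_two (2 * t + 1)
  rw [rhoCoeff, rhoCoeff, h1, h2]
  push_cast
  ring

theorem rhoZeroCoeff_succ {h j : ℕ} (hj : j < h) :
    (2 * h - 2 * j - 1 : ℚ) * rhoZeroCoeff (2 * h + 1) (j + 2) =
      -(2 * j + 2) * rhoZeroCoeff (2 * h + 1) (j + 1) := by
  obtain ⟨t, rfl⟩ := Nat.exists_eq_add_of_lt hj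
  have h1 : (2 * (j + 2) - 2)‼ = (2 * j + 2) * (2 * (j + 1) - 2)‼ :=
    Nat.doubleFactorial_add_two (2 * j)
  have h2 : (2 * (j + t + 1) + 1 - 2 * (j + 1))‼ =
      (2 * t + 1) * (2 * (j + t + 1) + 1 - 2 * (j + 2))‼ := by
    rw [show 2 * (j + t + 1) + 1 - 2 * (j + 1) = 2 * t + 1 by omega,
      show 2 * (j + t + 1) + 1 - 2 * (j + 2) = 2 * t - 1 by omega]
    rcases t with _ | t
    · rfl
    · exact Nat.doubleFactorial_add_two (2 * t + 1)
  rw [rhoZeroCoeff, rhoZeroCoeff, h1, h2, show j + 2 - 1 = j + 1 by omega,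
    Nat.add_sub_cancel]
  push_cast
  ring

theorem factorial_two_mul (m : ℕ) : (2 * m)! = (2 * m)‼ * (2 * m - 1)‼ := by
  rcases m with _ | m
  · rfl
  · exact Nat.factorial_eq_mul_doubleFactorial (2 * m + 1)

theorem oddPoly_eval {m j : ℕ} (hj : j ≤ m) :
    (oddPoly (2 * m) j).eval (-1 / 2 : ℚ) = rhoCoeff (2 * m) j := by
  let L : ℚ[X] →ₗ[ℚ] ℚ := leval (-1 / 2 : ℚ) ∘ₗ hilbertPoly_linearMap ℚ (2 * m + 1)
  have hLX : ∀ s, L (X ^ s) = (preHilbertPoly ℚ (2 * m) s).eval (-1 / 2 : ℚ) := fun s => by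
    rw [← hilbertPoly_X_pow_succ]
    rfl
  have hodd : ∀ j, (oddPoly (2 * m) j).eval (-1 / 2 : ℚ) =
      4 ^ j * L (X ^ j * (1 + X) ^ (2 * m - 2 * j)) := fun j => by
    change _ = (4 ^ j : ℚ) • L _
    rw [← map_smul]
    rfl
  have hL : ∀ s : ℕ, (((2 * m : ℕ) : ℚ) - 1 - s + 1 / 2) * L (X ^ (s + 1)) =
      -(s + 1 / 2) * L (X ^ s) := fun s => by
    have := congrArg (eval (-1 / 2 : ℚ)) (preHilbertPoly_succ (2 * m) s)
    simp only [eval_mul, eval_add, eval_sub, eval_X, eval_C, ← hLX] at this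
    linear_combination this
  -- Descending induction from `j = m`, where the numerator is a single monomial; both sides satisfy
  -- the same two-term recurrence in `j`.
  obtain ⟨t, hm⟩ : ∃ t, j + t = m := ⟨_, Nat.add_sub_of_le hj⟩
  clear hj
  clear_value L
  induction t generalizing j with
  | zero =>
    obtain rfl : j = m := by omega
    have hf : ((2 * j : ℕ)! : ℚ) ≠ 0 := by positivity
    have hd : ((2 * j)‼ : ℚ) ≠ 0 := by exact_mod_cast (Nat.doubleFactorial_pos _).ne'
    have hd' : ((2 * j - 1)‼ : ℚ) ≠ 0 := by exact_mod_cast (Nat.doubleFactorial_pos _).ne'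
    rw [hodd, Nat.sub_self, pow_zero, mul_one, hLX, preHilbertPoly, eval_smul, eval_comp,
      eval_add, eval_sub, eval_X, eval_C, eval_one,
      show (-1 / 2 - (j : ℚ) + 1) = 1 / 2 - j by ring, smul_eq_mul, mul_left_comm,
      ascPochhammer_eval_half, rhoCoeff, Nat.sub_self, factorial_two_mul]
    push_cast
    rw [Nat.doubleFactorial]
    field_simp
    simp
  | succ t ih =>
    have h1 := ih (j := j + 1) (by omega)
    have h2 := apply_X_pow_mul_one_add_X_pow L j (2 * t) (1 / 2) (fun s _ => by
      rw [show 2 * j + 2 * t + 2 = 2 * m by omega]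
      exact hL s)
    rw [hodd, show 2 * m - 2 * (j + 1) = 2 * t by omega] at h1
    rw [h1, show 2 * t + 2 = 2 * m - 2 * j by omega, ← hodd] at h2
    have h3 := rhoCoeff_succ (show j < m by omega)
    have hmj : (m : ℚ) = j + (t + 1) := by rw [← hm]; push_cast; ring
    have hne : (2 * j + 1 : ℚ) ≠ 0 := by positivity
    apply mul_left_cancel₀ hne
    rw [hmj] at h3
    push_cast at h2
    linear_combination h2 - h3

theorem evenPoly_derivative {h j : ℕ} (hj : j ≤ h) :
    (derivative (evenPoly (2 * h + 1) j)).eval 0 = 2 * rhoZeroCoeff (2 * h + 1) (j + 1) := by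
  let L : ℚ[X] →ₗ[ℚ] ℚ := leval (0 : ℚ) ∘ₗ derivative ∘ₗ
    hilbertPoly_linearMap ℚ (2 * h + 1 + 1) ∘ₗ LinearMap.mulLeft ℚ X
  have hLX : ∀ s, L (X ^ s) =
      (derivative (preHilbertPoly ℚ (2 * h + 1) (s + 1))).eval 0 := fun s => by
    rw [← hilbertPoly_X_pow_succ, pow_succ']
    rfl
  have heven : ∀ j, (derivative (evenPoly (2 * h + 1) j)).eval 0 =
      2 * (4 ^ j * L (X ^ j * (1 + X) ^ (2 * h - 2 * j))) := fun j => by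
    rw [← mul_assoc]
    change _ = (2 * 4 ^ j : ℚ) • L _
    rw [← map_smul]
    simp only [L, LinearMap.comp_apply, LinearMap.mulLeft_apply, mul_smul_comm]
    rfl
  -- These zeros leave only the derivative terms when the recurrence of `preHilbertPoly` is
  -- differentiated at 0.
  have hzero : ∀ s, s < 2 * h + 1 → (preHilbertPoly ℚ (2 * h + 1) (s + 1)).eval 0 = 0 :=
    fun s hs => by
    rw [preHilbertPoly, eval_smul, eval_comp, eval_add, eval_sub, eval_X, eval_C, eval_one,
      show (0 - ((s + 1 : ℕ) : ℚ) + 1) = -(s : ℚ) by push_cast; ring,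
      ascPochhammer_eval_neg_coe_nat_of_lt hs, smul_zero]
  have hL : ∀ s < 2 * h, (((2 * h : ℕ) : ℚ) - 1 - s + 1) * L (X ^ (s + 1)) =
      -(s + 1) * L (X ^ s) := fun s hs => by
    have := congrArg (fun p => eval 0 (derivative p)) (preHilbertPoly_succ (2 * h + 1) (s + 1))
    simp only [derivative_mul, derivative_add, derivative_sub, derivative_X, derivative_C,
      eval_mul, eval_add, eval_sub, eval_X, eval_C, eval_one, eval_zero, ← hLX,
      hzero s (by omega), hzero (s + 1) (by omega)] at this
    push_cast at this ⊢
    linear_combination this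
  obtain ⟨t, hm⟩ : ∃ t, j + t = h := ⟨_, Nat.add_sub_of_le hj⟩
  clear hj
  clear_value L
  induction t generalizing j with
  | zero =>
    obtain rfl : j = h := by omega
    have hf : ((2 * j + 1 : ℕ)! : ℚ) ≠ 0 := by positivity
    have hd : ((2 * j + 1)‼ : ℚ) ≠ 0 := by exact_mod_cast (Nat.doubleFactorial_pos _).ne'
    have hd' : ((2 * j)‼ : ℚ) ≠ 0 := by exact_mod_cast (Nat.doubleFactorial_pos _).ne'
    have h2 : ((2 * j)‼ : ℚ) = 2 ^ j * (j ! : ℕ) := by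
      rw [Nat.doubleFactorial_two_mul]; push_cast; rfl
    have hX : (X - C (((j + 1 : ℕ) : ℚ)) + 1 : ℚ[X]) = X - C (j : ℚ) := by
      push_cast
      rw [map_add, map_one]
      ring
    rw [heven, Nat.sub_self, pow_zero, mul_one, hLX, preHilbertPoly, hX, derivative_smul,
      eval_smul, derivative_ascPochhammer_comp, rhoZeroCoeff, Nat.add_sub_cancel,
      show 2 * (j + 1) - 2 = 2 * j by omega, show 2 * j + 1 - 2 * (j + 1) = 0 by omega,
      Nat.factorial_eq_mul_doubleFactorial, smul_eq_mul]
    push_cast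
    rw [Nat.doubleFactorial, Nat.cast_one, mul_one,
      show (4 : ℚ) ^ j = 2 ^ j * 2 ^ j by rw [← mul_pow]; norm_num]
    field_simp
    rw [h2]
    ring
  | succ t ih =>
    have h1 := ih (j := j + 1) (by omega)
    have h2 := apply_X_pow_mul_one_add_X_pow L j (2 * t) 1 (fun s hs => by
      rw [show 2 * j + 2 * t + 2 = 2 * h by omega] at hs ⊢
      exact hL s hs)
    rw [heven, show 2 * h - 2 * (j + 1) = 2 * t by omega] at h1
    have h4 := heven j
    rw [← show 2 * t + 2 = 2 * h - 2 * j by omega] at h4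
    rw [h4]
    have h3 := rhoZeroCoeff_succ (show j < h by omega)
    have hmj : (h : ℚ) = j + (t + 1) := by rw [← hm]; push_cast; ring
    have hne : (2 * j + 2 : ℚ) ≠ 0 := by positivity
    apply mul_left_cancel₀ hne
    rw [hmj] at h3
    push_cast at h2
    rw [show j + 1 + 1 = j + 2 by ring] at h1
    linear_combination 2 * h2 - 2 * h3 - (2 * t + 1 : ℚ) * h1

end Values

/-! ### Denominators and dimensions -/

section Dimension

/-- The dimension of the left ideal generated by the reduction of a rational idempotent. -/
theorem finrank_span_of_idempotent (k : Type*) [Field k] {G : Type*} [Group G] [Fintype G]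
    (c : G → ℚ) {D : ℤ} (hD : (D : k) ≠ 0) (hint : ∀ g, ∃ C : ℤ, (C : ℚ) = D * c g)
    (hc : ∀ x, ∑ y, c y * c (y⁻¹ * x) = c x) :
    (Module.finrank k (Ideal.span {∑ g, (c g : k) • MonoidAlgebra.of k G g} :
      Ideal (MonoidAlgebra k G)) : ℚ) = Fintype.card G * c 1 := by
  choose C hC using hint
  have hD0 : (D : ℚ) ≠ 0 := by
    rintro h
    have : D = 0 := by exact_mod_cast h
    simp [this] at hD
  -- Any denominator that is nonzero in `k` gives the same value as the reduced fraction.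
  have hcast : ∀ g, (c g : k) = (C g : k) / D := fun g => by
    have : c g = Rat.divInt (C g) D := by
      rw [Rat.divInt_eq_div, hC, mul_div_cancel_left₀ _ hD0]
    rw [this, Rat.cast_divInt_of_ne_zero _ hD]
  have hmul : ∀ x, ∑ y, C y * C (y⁻¹ * x) = D * C x := fun x => by
    have : ((∑ y, C y * C (y⁻¹ * x) : ℤ) : ℚ) = ((D * C x : ℤ) : ℚ) := by
      push_cast
      simp only [hC]
      rw [← hc x, Finset.mul_sum, Finset.mul_sum]
      exact Finset.sum_congr rfl fun y _ => by ring
    exact_mod_cast this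
  have h := finrank_span_of_quasiIdempotent k C hmul hD
  rw [Finset.sum_congr rfl fun g _ => congrArg (· • MonoidAlgebra.of k G g) (hcast g)]
  have h2 := congrArg (Int.cast : ℤ → ℚ) h
  push_cast at h2
  rw [hC] at h2
  apply mul_left_cancel₀ hD0
  rw [h2]
  ring

theorem sum_smul_sum_filter {k A ι : Type*} [Field k] [AddCommGroup A] [Module k A] [Fintype ι]
    (s : Finset ℕ) (f : ι → ℕ) (hf : ∀ i, f i ∈ s) (a : ℕ → k) (x : ι → A) :
    ∑ j ∈ s, a j • ∑ i with f i = j, x i = ∑ i, a (f i) • x i := by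
  rw [← Finset.sum_fiberwise_of_maps_to (s := Finset.univ) (t := s) (g := f) fun i _ => hf i]
  refine Finset.sum_congr rfl fun j _ => ?_
  rw [Finset.smul_sum]
  refine Finset.sum_congr rfl fun i hi => ?_
  rw [(Finset.mem_filter.mp hi).2]

theorem rho_eq_sum (k : Type*) [Field k] (n : ℕ) :
    rho k n = ∑ σ : Equiv.Perm (Fin n), (rhoCoeff n (peak σ).card : k) •
      MonoidAlgebra.of k (Equiv.Perm (Fin n)) σ := by
  simp only [rho, p]
  exact sum_smul_sum_filter _ _ (fun σ => by
    have := (sortCount_odd σ).1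
    rw [Finset.mem_range]
    omega) (fun j => (rhoCoeff n j : k)) _

theorem rhoZero_eq_sum (k : Type*) [Field k] {n : ℕ} (hn : n ≠ 0) :
    rhoZero k n = ∑ σ : Equiv.Perm (Fin n), (rhoZeroCoeff n ((peak σ \ {1}).card + 1) : k) •
      MonoidAlgebra.of k (Equiv.Perm (Fin n)) σ := by
  simp only [rhoZero, pInterior]
  refine Eq.trans (Finset.sum_congr rfl fun j hj => ?_)
    (sum_smul_sum_filter (Finset.Icc 1 ((n + 1) / 2))
      (fun σ : Equiv.Perm (Fin n) => (peak σ \ {1}).card + 1) (fun σ => by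
    have := (sortCount_even hn σ).1
    rw [Finset.mem_Icc]
    omega) (fun j => (rhoZeroCoeff n j : k)) _)
  congr 1
  refine Finset.sum_congr (Finset.filter_congr fun σ _ => ?_) fun _ _ => rfl
  have := (Finset.mem_Icc.mp hj).1
  omega

/-- These are the super Catalan numbers S(a,b) = (2a)! (2b)! / (a! b! (a+b)!), with S(a,0) the
central binomial coefficient. -/
theorem four_pow_mul_doubleFactorial_integral (a b : ℕ) : ∃ C : ℤ, (C : ℚ) =
    4 ^ (a + b) * (((2 * a - 1)‼ * (2 * b - 1)‼ : ℕ) / ((2 * (a + b))‼ : ℕ)) := by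
  induction b generalizing a with
  | zero =>
    refine ⟨Nat.centralBinom a, ?_⟩
    have h1 := factorial_two_mul a
    have h2 := Nat.choose_mul_factorial_mul_factorial (show a ≤ 2 * a by omega)
    rw [show 2 * a - a = a by omega, ← Nat.centralBinom_eq_two_mul_choose, h1,
      Nat.doubleFactorial_two_mul] at h2
    have h3 : ((Nat.centralBinom a * a ! * a ! : ℕ) : ℚ) = _ := congrArg Nat.cast h2
    have hf : ((a ! : ℕ) : ℚ) ≠ 0 := by positivity
    push_cast at h3
    rw [add_zero, mul_zero, Nat.doubleFactorial_two_mul]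
    push_cast
    rw [Nat.doubleFactorial, Nat.cast_one, mul_one,
      show (4 : ℚ) ^ a = 2 ^ a * 2 ^ a by rw [← mul_pow]; norm_num]
    field_simp
    apply mul_right_cancel₀ hf
    rw [h3]
    ring
  | succ b ih =>
    obtain ⟨C, hC⟩ := ih a
    obtain ⟨C', hC'⟩ := ih (a + 1)
    -- The identity is S(a,b+1) = 4 S(a,b) - S(a+1,b).
    refine ⟨4 * C - C', ?_⟩
    have hodd : ∀ a, (2 * (a + 1) - 1)‼ = (2 * a + 1) * (2 * a - 1)‼ := by
      rintro (_ | a)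
      · rfl
      · exact Nat.doubleFactorial_add_two (2 * a + 1)
    have heven : (2 * (a + b + 1))‼ = (2 * (a + b) + 2) * (2 * (a + b))‼ :=
      Nat.doubleFactorial_add_two (2 * (a + b))
    have hd : ((2 * (a + b))‼ : ℚ) ≠ 0 := by exact_mod_cast (Nat.doubleFactorial_pos _).ne'
    have hab : (2 * (a + b) + 2 : ℚ) ≠ 0 := by positivity
    rw [show a + 1 + b = a + b + 1 by ring, heven, hodd] at hC'
    rw [show a + (b + 1) = a + b + 1 by ring, heven, hodd]
    push_cast at hC hC' ⊢
    rw [hC, hC', pow_succ]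
    field_simp
    ring

theorem rhoCoeff_integral {m j : ℕ} (hj : j ≤ m) :
    ∃ C : ℤ, (C : ℚ) = ((4 ^ m : ℤ) : ℚ) * rhoCoeff (2 * m) j := by
  obtain ⟨b, rfl⟩ := Nat.exists_eq_add_of_le hj
  obtain ⟨C, hC⟩ := four_pow_mul_doubleFactorial_integral j b
  refine ⟨(-1) ^ j * C, ?_⟩
  rw [rhoCoeff, show 2 * (j + b) - 2 * j - 1 = 2 * b - 1 by omega]
  push_cast at hC ⊢
  rw [hC]
  ring

theorem peak_one (n : ℕ) : peak (1 : Equiv.Perm (Fin n)) = ∅ := by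
  rw [peak, Finset.filter_eq_empty_iff]
  rintro i hi ⟨-, hlt⟩
  rw [Finset.mem_Icc] at hi
  obtain ⟨i, rfl⟩ := Nat.exists_eq_add_of_le' hi.1
  rw [word_succ _ (by omega : i + 1 < n), word_succ _ (by omega : i < n)] at hlt
  simp at hlt

theorem finrank_span_rho (k : Type*) [Field k] (hk : (2 : k) ≠ 0) (m : ℕ) :
    Module.finrank k (Ideal.span {rho k (2 * m)} :
      Ideal (MonoidAlgebra k (Equiv.Perm (Fin (2 * m))))) = ((2 * m - 1)‼) ^ 2 := by
  have hbound : ∀ σ : Equiv.Perm (Fin (2 * m)), (peak σ).card ≤ m := fun σ => by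
    have := (sortCount_odd σ).1
    omega
  have h := finrank_span_of_idempotent k
    (fun σ : Equiv.Perm (Fin (2 * m)) => rhoCoeff (2 * m) (peak σ).card) (D := 4 ^ m)
    (by
      push_cast
      rw [show (4 : k) = 2 * 2 by norm_num]
      exact pow_ne_zero _ (mul_ne_zero hk hk))
    (fun σ => rhoCoeff_integral (hbound σ)) fun π => by
      -- The point -1/2 is idempotent for the product 2st + s + t.
      have h := oddPoly_convolution (-1 / 2) (-1 / 2) π
      rw [show (2 * (-1 / 2) * (-1 / 2) + 1 * (-1 / 2 + -1 / 2) : ℚ) = -1 / 2 by norm_num] at h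
      simpa only [oddPoly_eval (hbound _)] using h
  rw [← rho_eq_sum, Fintype.card_perm, Fintype.card_fin] at h
  have hd : ((2 * m)‼ : ℚ) ≠ 0 := by exact_mod_cast (Nat.doubleFactorial_pos _).ne'
  -- The identity has no peaks, so the trace is (2m)! (2m-1)!! / (2m)!!.
  rw [peak_one, Finset.card_empty, rhoCoeff, factorial_two_mul, mul_zero, Nat.zero_sub, Nat.sub_zero,
    Nat.doubleFactorial, pow_zero, one_mul, one_mul] at h
  push_cast at h
  rw [mul_comm ((2 * m)‼ : ℚ), mul_assoc, mul_div_cancel₀ _ hd, ← sq] at h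
  exact_mod_cast h

theorem finrank_span_rhoZero (k : Type*) [Field k] (m : ℕ) (hk : (((2 * m + 1)‼ : ℕ) : k) ≠ 0) :
    Module.finrank k (Ideal.span {rhoZero k (2 * m + 1)} :
      Ideal (MonoidAlgebra k (Equiv.Perm (Fin (2 * m + 1))))) = (2 * m)! := by
  have hn : 2 * m + 1 ≠ 0 := by omega
  have hbound : ∀ σ : Equiv.Perm (Fin (2 * m + 1)), (peak σ \ {1}).card ≤ m := fun σ => by
    have := (sortCount_even hn σ).1
    omega
  have hd : ((2 * m + 1)‼ : ℚ) ≠ 0 := by exact_mod_cast (Nat.doubleFactorial_pos _).ne'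
  have h := finrank_span_of_idempotent k
    (fun σ : Equiv.Perm (Fin (2 * m + 1)) => rhoZeroCoeff (2 * m + 1) ((peak σ \ {1}).card + 1))
    (D := ((2 * m + 1)‼ : ℕ)) (by exact_mod_cast hk)
    (fun σ => ⟨(-1) ^ (peak σ \ {1}).card * ((2 * ((peak σ \ {1}).card + 1) - 2)‼ *
      (2 * m + 1 - 2 * ((peak σ \ {1}).card + 1))‼ : ℕ), by
        rw [rhoZeroCoeff, Nat.add_sub_cancel, Int.cast_natCast, mul_div_cancel₀ _ hd]
        push_cast
        ring⟩) fun π => by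
      have h := convolution_derivative_eq
        (fun σ : Equiv.Perm (Fin (2 * m + 1)) => evenPoly (2 * m + 1) (peak σ \ {1}).card)
        (evenPoly_convolution hn) π
      simp only [evenPoly_derivative (hbound _)] at h
      -- The derivatives are twice the coefficients, so both sides of `h` carry a factor 4.
      apply mul_left_cancel₀ (four_ne_zero (α := ℚ))
      rw [Finset.mul_sum]
      refine Eq.trans (Finset.sum_congr rfl fun σ _ => ?_) (h.trans ?_) <;> ring
  rw [← rhoZero_eq_sum k hn, Fintype.card_perm, Fintype.card_fin] at h
  rw [peak_one, Finset.empty_sdiff, Finset.card_empty, rhoZeroCoeff,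
    Nat.factorial_eq_mul_doubleFactorial] at h
  rw [show 2 * (0 + 1) - 2 = 0 by omega, show 2 * m + 1 - 2 * (0 + 1) = 2 * m - 1 by omega,
    Nat.doubleFactorial, one_mul, pow_zero, one_mul] at h
  push_cast at h
  rw [mul_right_comm, mul_div_cancel₀ _ hd] at h
  rw [factorial_two_mul, mul_comm (2 * m)‼]
  exact_mod_cast h

end Dimension

end PeakAlgebra

theorem proposition5p3 (k : Type*) [Field k] (hk : ringChar k ≠ 2) (n : ℕ) :
    (Even n →
      Module.finrank k (Ideal.span {PeakAlgebra.rho k n} :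
        Ideal (MonoidAlgebra k (Equiv.Perm (Fin n)))) = ((n - 1)‼) ^ 2) ∧
    (Odd n → ((n‼ : ℕ) : k) ≠ 0 →
      Module.finrank k (Ideal.span {PeakAlgebra.rhoZero k n} :
        Ideal (MonoidAlgebra k (Equiv.Perm (Fin n)))) = (n - 1)!) := by
  constructor
  · rintro ⟨m, rfl⟩
    rw [← two_mul]
    exact PeakAlgebra.finrank_span_rho k (Ring.two_ne_zero hk) m
  · rintro ⟨h, rfl⟩ hn
    exact PeakAlgebra.finrank_span_rhoZero k h hn
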